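/- Let $\Omega$ be a topological space, let $q:\mathbb R^n\times\Omega\to\mathbb R^m$ be continuous, and let $P=\bigcup_{i=1}^p P_i\subset\mathbb R^m$ be a union of finitely many convex polyhedra $P_i=\{y : a_{ij}^Ty\le b_{ij},\ j=1,\dots,m_i\}$. Put $\mathcal F(\omega)=\{x\in\mathbb R^n : q(x,\omega)\in P\}$, let $\bar\omega\in\Omega$ and $\bar x\in\mathcal F(\bar\omega)$. Assume that there are neighborhoods $U$ of $\bar x$ and $W_0$ of $\bar\omega$ such that $q$ is twice partially differentiable with respect to $x$ on $U\times W_0$, that $\nabla_xq$ and $\nabla_x^2q$ are continuous at $(\bar x,\bar\omega)$, and that $\nabla_x^2q(\cdot,\omega)$ is continuous on $U$ for every $\omega\in W_0$. For $\Gamma\subset\mathbb R^m$ closed, $y\in\Gamma$ and $v\in\mathbb R^m$ let $$T(y;\Gamma)=\{z : \exists\, z_k\to z,\ t_k\downarrow0 \text{ with } y+t_kz_k\in\Gamma\ \forall k\},$$ $$\hat N(y;\Gamma)=\Big\{\xi : \limsup_{y'\to y,\ y'\in\Gamma}\frac{\xi^T(y'-y)}{\|y'-y\|}\le0\Big\},$$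 $$N(y;\Gamma;v)=\{\xi : \exists\, t_k\downarrow0,\ v_k\to v,\ \xi_k\to\xi \text{ with } \xi_k\in\hat N(y+t_kv_k;\Gamma)\ \forall k\},$$ where these cones are empty at points outside $\Gamma$. Let $T^{\rm lin}_{\bar\omega}(\bar x)=\{u\in\mathbb R^n : \nabla_xq(\bar x,\bar\omega)u\in T(q(\bar x,\bar\omega);P)\}$ and, for $l\in\{1,2\}$, $$e_l(\omega)=\|\nabla_xq(\bar x,\omega)-\nabla_xq(\bar x,\bar\omega)\|+\|q(\bar x,\omega)-q(\bar x,\bar\omega)\|^{1/l}.$$ Norms are Euclidean (and operator) norms, and $\operatorname{dist}(\bar x,\emptyset)=+\infty$. 1. Assume that there is some $0\ne u\in T^{\rm lin}_{\bar\omega}(\bar x)$ such that $$\nabla_xq(\bar x,\bar\omega)^T\lambda=0,\ \ \lambda\in N(q(\bar x,\bar\omega);P;\nabla_xq(\bar x,\bar\omega)u)\ \Longrightarrow\ \lambda=0.$$ Then there are a constant $\kappa>0$ and a neighborhood $W$ of $\bar\omega$ such that for all $\omega\in W$ $$\operatorname{dist}(\bar x,\mathcal F(\omega))\le\kappa\|q(\bar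 x,\omega)-q(\bar x,\bar\omega)\|\le\kappa e_1(\omega);$$ in particular $\mathcal F(\omega)\neq\emptyset$. 2. Assume that there is some $0\ne u\in T^{\rm lin}_{\bar\omega}(\bar x)$ such that $$\nabla_xq(\bar x,\bar\omega)^T\lambda=0,\ \ \lambda\in N(q(\bar x,\bar\omega);P;\nabla_xq(\bar x,\bar\omega)u),\ \ u^T\nabla_x^2(\lambda^Tq)(\bar x,\bar\omega)u\ge0\ \Longrightarrow\ \lambda=0.$$ Then there are a constant $\kappa>0$ and a neighborhood $W$ of $\bar\omega$ such that for all $\omega\in W$ $$\operatorname{dist}(\bar x,\mathcal F(\omega))\le\kappa e_2(\omega);$$ in particular $\mathcal F(\omega)\neq\emptyset$. -/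

import Mathlib

open Filter Topology

noncomputable section

/-- The contingent (Bouligand) cone `T(x; Γ)`: all `u` for which there are `u_k → u` and
`t_k ↓ 0` with `x + t_k u_k ∈ Γ` for all `k`; it is empty when `x ∉ Γ`. -/
def contingentCone {E : Type*} [NormedAddCommGroup E] [NormedSpace ℝ E]
    (Γ : Set E) (x : E) : Set E :=
  {u | x ∈ Γ ∧ ∃ (t : ℕ → ℝ) (v : ℕ → E), (∀ k, 0 < t k) ∧ Tendsto t atTop (𝓝 0) ∧
    Tendsto v atTop (𝓝 u) ∧ ∀ k, x + t k • v k ∈ Γ}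

/-- The regular (Fréchet) normal cone `N̂(x; Γ)`: all `ξ` such that the upper limit of
`⟪ξ, y - x⟫ / ‖y - x‖`, as `y → x` within `Γ`, is at most `0`; it is empty when `x ∉ Γ`. -/
def regularNormalCone {E : Type*} [NormedAddCommGroup E] [InnerProductSpace ℝ E]
    (Γ : Set E) (x : E) : Set E :=
  {ξ | x ∈ Γ ∧ ∀ ε : ℝ, 0 < ε → ∀ᶠ y in 𝓝[Γ] x, inner ℝ ξ (y - x) ≤ ε * ‖y - x‖}

/-- The limiting normal cone `N(x; Γ; u)` in direction `u`: all limits of `ξ_k` with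
`ξ_k ∈ N̂(x + t_k u_k; Γ)` for some `t_k ↓ 0` and `u_k → u`. -/
def directionalNormalCone {E : Type*} [NormedAddCommGroup E] [InnerProductSpace ℝ E]
    (Γ : Set E) (x u : E) : Set E :=
  {ξ | x ∈ Γ ∧ ∃ (t : ℕ → ℝ) (v ζ : ℕ → E), (∀ k, 0 < t k) ∧ Tendsto t atTop (𝓝 0) ∧
    Tendsto v atTop (𝓝 u) ∧ Tendsto ζ atTop (𝓝 ξ) ∧
    ∀ k, ζ k ∈ regularNormalCone Γ (x + t k • v k)}

/-- The union of the convex polyhedra `{y | ⟪a i j, y⟫ ≤ b i j for all j}`, over all `i`. -/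
def polyhedralUnion {m p : ℕ} {r : Fin p → ℕ}
    (a : (i : Fin p) → Fin (r i) → EuclideanSpace ℝ (Fin m)) (b : (i : Fin p) → Fin (r i) → ℝ) :
    Set (EuclideanSpace ℝ (Fin m)) :=
  ⋃ i : Fin p, {y | ∀ j : Fin (r i), inner ℝ (a i j) y ≤ b i j}

variable {n m : ℕ} {Ω : Type*}

/-- The partial derivative `∇ₓ q(x, ω)`. -/
def gradX (q : EuclideanSpace ℝ (Fin n) → Ω → EuclideanSpace ℝ (Fin m))
    (x : EuclideanSpace ℝ (Fin n)) (ω : Ω) :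
    EuclideanSpace ℝ (Fin n) →L[ℝ] EuclideanSpace ℝ (Fin m) :=
  fderiv ℝ (fun y => q y ω) x

/-- The second partial derivative `∇ₓ² q(x, ω)`. -/
def hessX (q : EuclideanSpace ℝ (Fin n) → Ω → EuclideanSpace ℝ (Fin m))
    (x : EuclideanSpace ℝ (Fin n)) (ω : Ω) :
    EuclideanSpace ℝ (Fin n) →L[ℝ] EuclideanSpace ℝ (Fin n) →L[ℝ] EuclideanSpace ℝ (Fin m) :=
  fderiv ℝ (fun y => gradX q y ω) x

/-- The quadratic form `uᵀ ∇ₓ² (λᵀ q)(x, ω) u` of the scalar function `λᵀ q`. -/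
def hessForm (q : EuclideanSpace ℝ (Fin n) → Ω → EuclideanSpace ℝ (Fin m))
    (lam : EuclideanSpace ℝ (Fin m)) (x : EuclideanSpace ℝ (Fin n)) (ω : Ω)
    (u : EuclideanSpace ℝ (Fin n)) : ℝ :=
  fderiv ℝ (fun y => fderiv ℝ (fun z => inner ℝ lam (q z ω)) y) x u u

/-- The standing smoothness assumption on `q` near `(x₀, ω₀)`. -/
structure BasicAssumption [TopologicalSpace Ω]
    (q : EuclideanSpace ℝ (Fin n) → Ω → EuclideanSpace ℝ (Fin m))
    (x₀ : EuclideanSpace ℝ (Fin n)) (ω₀ : Ω) : Prop where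
  continuous_q : Continuous (fun z : EuclideanSpace ℝ (Fin n) × Ω => q z.1 z.2)
  exists_nhds : ∃ U ∈ 𝓝 x₀, ∃ W ∈ 𝓝 ω₀,
    (∀ x ∈ U, ∀ ω ∈ W, DifferentiableAt ℝ (fun y => q y ω) x ∧
      DifferentiableAt ℝ (fun y => gradX q y ω) x) ∧
    (∀ ω ∈ W, ContinuousOn (fun x => hessX q x ω) U)
  continuousAt_grad :
    ContinuousAt (fun z : EuclideanSpace ℝ (Fin n) × Ω => gradX q z.1 z.2) (x₀, ω₀)
  continuousAt_hess :
    ContinuousAt (fun z : EuclideanSpace ℝ (Fin n) × Ω => hessX q z.1 z.2) (x₀, ω₀)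

/-- The feasible set `𝓕(ω) = {x | q(x, ω) ∈ P}`. -/
def feasibleSet (q : EuclideanSpace ℝ (Fin n) → Ω → EuclideanSpace ℝ (Fin m))
    (P : Set (EuclideanSpace ℝ (Fin m))) (ω : Ω) : Set (EuclideanSpace ℝ (Fin n)) :=
  {x | q x ω ∈ P}

/-- The linearized cone `{u | ∇ₓ q(x, ω) u ∈ T(q(x, ω); P)}`. -/
def linearizedCone (q : EuclideanSpace ℝ (Fin n) → Ω → EuclideanSpace ℝ (Fin m))
    (P : Set (EuclideanSpace ℝ (Fin m))) (ω : Ω) (x : EuclideanSpace ℝ (Fin n)) :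
    Set (EuclideanSpace ℝ (Fin n)) :=
  {u | gradX q x ω u ∈ contingentCone P (q x ω)}

/-- The perturbation measure
`e_l(ω) = ‖∇ₓ q(x₀, ω) - ∇ₓ q(x₀, ω₀)‖ + ‖q(x₀, ω) - q(x₀, ω₀)‖ ^ (1 / l)`. -/
def perturbation (q : EuclideanSpace ℝ (Fin n) → Ω → EuclideanSpace ℝ (Fin m))
    (x₀ : EuclideanSpace ℝ (Fin n)) (ω₀ : Ω) (l : ℕ) (ω : Ω) : ℝ :=
  ‖gradX q x₀ ω - gradX q x₀ ω₀‖ + ‖q x₀ ω - q x₀ ω₀‖ ^ (1 / (l : ℝ))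

end

/-!
Write `A` and `H` for the first and second `x`-derivatives of `q` at `(x₀, ω₀)` and `y₀` for
`q x₀ ω₀`. Since `P` is a finite union of polyhedra, `y₀ + t • A u` lies in `P` for all small
`t > 0`. A feasible point for the parameter `ω` is sought in the ball of radius `ρ * t` around
`x₁ = x₀ + t • u`, where `t` is a large multiple of the perturbation measure at `ω`; it is then at
distance `O(t)` from `x₀`. If `t = 0`, the point `x₀` itself is feasible.

If there is no such point, a minimizer `x` of the distance of `q x ω` to `P` plus `σ * ‖x - x₁‖`
over the ball is an interior point, provided `σ * ρ * t` exceeds the residual at `x₁`. With a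
nearest point `y` of `P` to `q x ω`, the unit vector `ξ` in direction `q x ω - y` is a regular
normal to `P` at `y`, the adjoint of the derivative maps `ξ` to a vector of norm at most `σ`, and
`ξ` has nonpositive inner product with the derivative in direction `x - x₁`
(`exists_normal_of_forall_notMem`). Moreover `y = y₀ + t • v` with `v` close to `A u`.

* First order: the residual at `x₁` is a small multiple of `t`, so that `σ` can be taken small.
  This contradicts the hypothesis on directional limiting normals in its compactness form
  (`exists_pos_forall_regularNormalCone_of_directionalNormalCone`); see
  `exists_mem_of_firstOrder`.
* Second order: the residual is `O(t ^ 2)` and `σ = O(t)`. Near `y₀` and in directions near `A u`,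
  the polyhedral structure makes `ξ` orthogonal to both `v` and `A u`
  (`exists_pos_forall_inner_eq_zero`). So the first-order part of the positive number
  `inner ℝ ξ (q x ω - y)` reduces to `inner ℝ ξ (A (x - x₁))`, which the radial optimality
  condition bounds above by a small multiple of `t ^ 2`. Hence `inner ℝ ξ (H u u)` is at least a
  small negative number (`lt_inner_bilin_of_normal`), again contradicting the compactness form of
  the hypothesis; see `exists_mem_of_secondOrder`.
-/

/-! ### Regular and directional normals -/

section Cones

variable {F : Type*} [NormedAddCommGroup F] [InnerProductSpace ℝ F]

/-- The unit vector pointing from a nearest point `y` of `P` to `z` is a regular normal to `P`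
at `y`. -/
theorem unit_sub_mem_regularNormalCone {P : Set F} {y z : F} (hy : y ∈ P)
    (hmin : ∀ y' ∈ P, ‖z - y‖ ≤ ‖z - y'‖) :
    ‖z - y‖⁻¹ • (z - y) ∈ regularNormalCone P y := by
  refine ⟨hy, fun ε hε => ?_⟩
  rcases eq_or_ne z y with rfl | hne
  · exact Eventually.of_forall fun y' => by simpa using by positivity
  have hpos : 0 < ‖z - y‖ := norm_pos_iff.2 (sub_ne_zero.2 hne)
  have hball : Metric.ball y (2 * ε * ‖z - y‖) ∈ 𝓝[P] y :=
    mem_nhdsWithin_of_mem_nhds (Metric.ball_mem_nhds _ (by positivity))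
  filter_upwards [hball, self_mem_nhdsWithin] with y' hy' hy'P
  have hlt : ‖y' - y‖ < 2 * ε * ‖z - y‖ := by simpa [dist_eq_norm] using hy'
  have hle := hmin y' hy'P
  -- expanding `‖z - y'‖ ^ 2` turns minimality into a quadratic bound on the inner product
  have hsq : ‖z - y'‖ ^ 2 = ‖z - y‖ ^ 2 - 2 * inner ℝ (z - y) (y' - y) + ‖y' - y‖ ^ 2 := by
    rw [← norm_sub_sq_real]
    congr 2
    abel
  have h2 : inner ℝ (z - y) (y' - y) ≤ ε * ‖z - y‖ * ‖y' - y‖ := by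
    nlinarith [norm_nonneg (z - y), norm_nonneg (y' - y)]
  rw [real_inner_smul_left, inv_mul_le_iff₀ hpos]
  linarith

/-- A regular normal is orthogonal to every line that stays in the set near the base point. -/
theorem inner_eq_zero_of_mem_regularNormalCone {P : Set F} {y d ξ : F}
    (hξ : ξ ∈ regularNormalCone P y) (hd : ∀ᶠ s : ℝ in 𝓝 0, y + s • d ∈ P) :
    inner ℝ ξ d = 0 := by
  have hT : Tendsto (fun s : ℝ => y + s • d) (𝓝 0) (𝓝[P] y) := by
    refine tendsto_nhdsWithin_iff.2 ⟨?_, hd⟩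
    have : ContinuousAt (fun s : ℝ => y + s • d) 0 := by fun_prop
    simpa [ContinuousAt] using this
  have key : ∀ ε : ℝ, 0 < ε → |inner ℝ ξ d| ≤ ε * ‖d‖ := by
    intro ε hε
    obtain ⟨δ, hδ, h⟩ := Metric.eventually_nhds_iff.1 (hT.eventually (hξ.2 ε hε))
    have h1 := @h (δ / 2) (by rw [Real.dist_eq, sub_zero, abs_of_pos] <;> linarith)
    have h2 := @h (-(δ / 2)) (by rw [Real.dist_eq, sub_zero, abs_neg, abs_of_pos] <;> linarith)
    simp only [add_sub_cancel_left, norm_smul, real_inner_smul_right, Real.norm_eq_abs, abs_neg,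
      abs_of_pos (half_pos hδ)] at h1 h2
    rw [abs_le]
    constructor <;> nlinarith
  by_contra hne
  have hpos : 0 < |inner ℝ ξ d| := abs_pos.2 hne
  have h := key (|inner ℝ ξ d| / (2 * (‖d‖ + 1))) (by positivity)
  rw [div_mul_eq_mul_div, le_div_iff₀ (by positivity)] at h
  nlinarith [norm_nonneg d]

/-- Compactness form of a hypothesis on the directional limiting normal cone: regular normals of
unit length at points `y + t • v`, with `t > 0` small and `v` near `w`, violate the
hypothesis on `A` and `z` by a uniform amount. -/
theorem exists_pos_forall_regularNormalCone_of_directionalNormalCone [ProperSpace F]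
    {E : Type*} [NormedAddCommGroup E] [InnerProductSpace ℝ E] [CompleteSpace E]
    {P : Set F} {y w z : F} (hy : y ∈ P) (A : E →L[ℝ] F)
    (h : ∀ lam ∈ directionalNormalCone P y w, ContinuousLinearMap.adjoint A lam = 0 →
      0 ≤ inner ℝ lam z → lam = 0) :
    ∃ c : ℝ, 0 < c ∧ ∀ (t : ℝ) (v ξ : F), 0 < t → t < c → ‖v - w‖ < c →
      ξ ∈ regularNormalCone P (y + t • v) → ‖ξ‖ = 1 →
      ‖ContinuousLinearMap.adjoint A ξ‖ < c → inner ℝ ξ z ≤ -c := by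
  by_contra! hcon
  choose t v ξ ht htc hvc hξ hξ1 hA hz using
    fun k : ℕ => hcon (1 / ((k : ℝ) + 1)) Nat.one_div_pos_of_nat
  obtain ⟨ξ₀, hξ₀, φ, hφ, hlim⟩ := (isCompact_sphere (0 : F) 1).tendsto_subseq
    (x := ξ) (fun k => by simpa using hξ1 k)
  have hε : Tendsto (fun k : ℕ => 1 / ((φ k : ℝ) + 1)) atTop (𝓝 0) :=
    tendsto_one_div_add_atTop_nhds_zero_nat.comp hφ.tendsto_atTop
  have hAξ : ContinuousLinearMap.adjoint A ξ₀ = 0 := by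
    refine tendsto_nhds_unique
      (((ContinuousLinearMap.adjoint A).continuous.tendsto ξ₀).comp hlim) ?_
    exact squeeze_zero_norm (fun k => (hA (φ k)).le) hε
  have hzξ : 0 ≤ inner ℝ ξ₀ z := by
    have h1 : Tendsto (fun k => inner ℝ (ξ (φ k)) z) atTop (𝓝 (inner ℝ ξ₀ z)) :=
      hlim.inner tendsto_const_nhds
    have h2 := hε.neg
    rw [neg_zero] at h2
    exact le_of_tendsto_of_tendsto' h2 h1 fun k => (hz (φ k)).le
  have h0 : ξ₀ = 0 := by
    refine h ξ₀ ⟨hy, fun k => t (φ k), fun k => v (φ k), fun k => ξ (φ k), fun k => ht _,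
      squeeze_zero (fun k => (ht _).le) (fun k => (htc _).le) hε, ?_, hlim, fun k => hξ _⟩ hAξ hzξ
    exact tendsto_iff_norm_sub_tendsto_zero.2
      (squeeze_zero (fun k => norm_nonneg _) (fun k => (hvc _).le) hε)
  simp [h0] at hξ₀

end Cones

/-! ### Local structure of unions of polyhedra -/

section Polyhedral

variable {m p : ℕ} {r : Fin p → ℕ}
  {a : (i : Fin p) → Fin (r i) → EuclideanSpace ℝ (Fin m)} {b : (i : Fin p) → Fin (r i) → ℝ}

theorem isClosed_polyhedralUnion : IsClosed (polyhedralUnion a b) := by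
  refine isClosed_iUnion_of_finite fun i => ?_
  simp only [Set.ofPred_forall]
  exact isClosed_iInter fun j => isClosed_le (by fun_prop) continuous_const

theorem mem_polyhedralUnion {y : EuclideanSpace ℝ (Fin m)} :
    y ∈ polyhedralUnion a b ↔ ∃ i, ∀ j, inner ℝ (a i j) y ≤ b i j := by
  simp [polyhedralUnion]

/-- If a half-space contains `y + t • v` with `t > 0` small and `v` near `w`, then it contains
the initial piece of the ray from `y` in direction `w`. -/
theorem eventually_halfSpace_ray {F : Type*} [NormedAddCommGroup F] [InnerProductSpace ℝ F]
    (α : F) (β : ℝ) (y w : F) :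
    ∀ᶠ z : ℝ × F in 𝓝[>] 0 ×ˢ 𝓝 w, inner ℝ α (y + z.1 • z.2) ≤ β →
      ∀ᶠ τ : ℝ in 𝓝[>] 0, inner ℝ α (y + τ • w) ≤ β := by
  have hc : ContinuousAt (fun z : ℝ × F => inner ℝ α (y + z.1 • z.2)) (0, w) := by fun_prop
  have hle : (𝓝[>] (0 : ℝ)) ×ˢ 𝓝 w ≤ 𝓝 ((0 : ℝ), w) := by
    rw [nhds_prod_eq]
    exact prod_mono_left _ nhdsWithin_le_nhds
  rcases lt_trichotomy (inner ℝ α y) β with h | h | h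
  · have hc2 : ContinuousAt (fun τ : ℝ => inner ℝ α (y + τ • w)) 0 := by fun_prop
    have := hc2.eventually_lt continuousAt_const (by simpa using h : _ < β)
    exact Eventually.of_forall fun _ _ => (this.filter_mono nhdsWithin_le_nhds).mono
      fun _ h => h.le
  · rcases le_or_gt (inner ℝ α w) 0 with hw | hw
    · refine Eventually.of_forall fun _ _ => ?_
      filter_upwards [self_mem_nhdsWithin] with τ hτ
      rw [inner_add_right, real_inner_smul_right]
      nlinarith [Set.mem_Ioi.1 hτ]
    · have hv : ∀ᶠ v in 𝓝 w, 0 < inner ℝ α v :=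
        continuousAt_const.eventually_lt (by fun_prop : ContinuousAt (fun v => inner ℝ α v) w) hw
      have h1 : ∀ᶠ t : ℝ in 𝓝[>] 0, 0 < t := self_mem_nhdsWithin
      filter_upwards [h1.prod_mk hv] with z hz hz'
      rw [inner_add_right, real_inner_smul_right] at hz'
      nlinarith [mul_pos hz.1 hz.2]
  · filter_upwards [hle (continuousAt_const.eventually_lt hc (by simpa using h : β < _))]
      with z hz hz'
    exact absurd hz' (not_le.2 hz)

/-- If `y + t • v` lies in a half-space, `t > 0` is small and `v` is near `w`, then the lines
through this point in the directions `v` and `w` stay in the half-space near this point. -/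
theorem eventually_halfSpace_lines {F : Type*} [NormedAddCommGroup F] [InnerProductSpace ℝ F]
    (α : F) (β : ℝ) (y w : F) :
    ∀ᶠ z : ℝ × F in 𝓝[>] 0 ×ˢ 𝓝 w, inner ℝ α (y + z.1 • z.2) ≤ β →
      ∀ᶠ s : ℝ in 𝓝 0, inner ℝ α (y + z.1 • z.2 + s • z.2) ≤ β ∧
        inner ℝ α (y + z.1 • z.2 + s • w) ≤ β := by
  have hc : ContinuousAt (fun z : ℝ × F => inner ℝ α (y + z.1 • z.2)) (0, w) := by fun_prop
  have hle : (𝓝[>] (0 : ℝ)) ×ˢ 𝓝 w ≤ 𝓝 ((0 : ℝ), w) := by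
    rw [nhds_prod_eq]
    exact prod_mono_left _ nhdsWithin_le_nhds
  -- a constraint that is strict at a point stays strict along every line through it
  have hstrict : ∀ x d : F, inner ℝ α x < β → ∀ᶠ s : ℝ in 𝓝 0, inner ℝ α (x + s • d) ≤ β := by
    intro x d hx
    have hc2 : ContinuousAt (fun s : ℝ => inner ℝ α (x + s • d)) 0 := by fun_prop
    exact (hc2.eventually_lt continuousAt_const (by simpa using hx : _ < β)).mono fun _ h => h.le
  have h1 : ∀ᶠ t : ℝ in 𝓝[>] 0, 0 < t := self_mem_nhdsWithin
  have hpos : ∀ᶠ z : ℝ × F in 𝓝[>] 0 ×ˢ 𝓝 w, 0 < z.1 := h1.prod_inl _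
  rcases lt_trichotomy (inner ℝ α y) β with h | h | h
  · filter_upwards [hle (hc.eventually_lt continuousAt_const (by simpa using h : _ < β))]
      with z hz _
    exact (hstrict _ _ hz).and (hstrict _ _ hz)
  · rcases lt_trichotomy (inner ℝ α w) 0 with hw | hw | hw
    · have hv : ∀ᶠ v in 𝓝 w, inner ℝ α v < 0 :=
        (by fun_prop : ContinuousAt (fun v => inner ℝ α v) w).eventually_lt continuousAt_const hw
      filter_upwards [h1.prod_mk hv] with z hz _
      have hz' : inner ℝ α (y + z.1 • z.2) < β := by
        rw [inner_add_right, real_inner_smul_right]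
        nlinarith [mul_neg_of_pos_of_neg hz.1 hz.2]
      exact (hstrict _ _ hz').and (hstrict _ _ hz')
    · filter_upwards [hpos] with z hz hz'
      have hs : ∀ᶠ s : ℝ in 𝓝 0, -z.1 < s := lt_mem_nhds (by linarith)
      filter_upwards [hs] with s hs
      simp only [inner_add_right, real_inner_smul_right, hw, h] at hz' ⊢
      have hz2 : inner ℝ α z.2 ≤ 0 := by nlinarith
      constructor <;> nlinarith
    · have hv : ∀ᶠ v in 𝓝 w, 0 < inner ℝ α v :=
        continuousAt_const.eventually_lt (by fun_prop : ContinuousAt (fun v => inner ℝ α v) w) hw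
      filter_upwards [h1.prod_mk hv] with z hz hz'
      rw [inner_add_right, real_inner_smul_right] at hz'
      nlinarith [mul_pos hz.1 hz.2]
  · filter_upwards [hle (continuousAt_const.eventually_lt hc (by simpa using h : β < _))]
      with z hz hz'
    exact absurd hz' (not_le.2 hz)

/-- A union of finitely many polyhedra contains an initial piece of each of its tangent rays. -/
theorem eventually_add_smul_mem_polyhedralUnion {y w : EuclideanSpace ℝ (Fin m)}
    (hw : w ∈ contingentCone (polyhedralUnion a b) y) :
    ∀ᶠ τ : ℝ in 𝓝[>] 0, y + τ • w ∈ polyhedralUnion a b := by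
  obtain ⟨-, t, v, ht, ht0, hv, hmem⟩ := hw
  have hT : Tendsto (fun k => (t k, v k)) atTop (𝓝[>] 0 ×ˢ 𝓝 w) :=
    (tendsto_nhdsWithin_iff.2 ⟨ht0, Eventually.of_forall ht⟩).prodMk hv
  have hall : ∀ᶠ k in atTop, ∀ i j, inner ℝ (a i j) (y + t k • v k) ≤ b i j →
      ∀ᶠ τ : ℝ in 𝓝[>] 0, inner ℝ (a i j) (y + τ • w) ≤ b i j :=
    eventually_all.2 fun i => eventually_all.2 fun j =>
      hT.eventually (eventually_halfSpace_ray (a i j) (b i j) y w)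
  obtain ⟨k, hk⟩ := hall.exists
  obtain ⟨i, hi⟩ := mem_polyhedralUnion.1 (hmem k)
  exact (eventually_all.2 fun j => hk i j (hi j)).mono fun τ h => mem_polyhedralUnion.2 ⟨i, h⟩

/-- Regular normals to a union of finitely many polyhedra at `y + t • v`, with `t > 0` small and
`v` near `w`, are orthogonal to both `v` and `w`. -/
theorem exists_pos_forall_inner_eq_zero (y w : EuclideanSpace ℝ (Fin m)) :
    ∃ δ : ℝ, 0 < δ ∧ ∀ (t : ℝ) (v ξ : EuclideanSpace ℝ (Fin m)), 0 < t → t < δ → ‖v - w‖ < δ →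
      ξ ∈ regularNormalCone (polyhedralUnion a b) (y + t • v) →
      inner ℝ ξ v = 0 ∧ inner ℝ ξ w = 0 := by
  have hall : ∀ᶠ z : ℝ × EuclideanSpace ℝ (Fin m) in 𝓝[>] 0 ×ˢ 𝓝 w, ∀ i j,
      inner ℝ (a i j) (y + z.1 • z.2) ≤ b i j →
      ∀ᶠ s : ℝ in 𝓝 0, inner ℝ (a i j) (y + z.1 • z.2 + s • z.2) ≤ b i j ∧
        inner ℝ (a i j) (y + z.1 • z.2 + s • w) ≤ b i j :=
    eventually_all.2 fun i => eventually_all.2 fun j =>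
      eventually_halfSpace_lines (a i j) (b i j) y w
  obtain ⟨p₁, hp₁, p₂, hp₂, hp⟩ := eventually_prod_iff.1 hall
  obtain ⟨δ₁, hδ₁, h₁⟩ := mem_nhdsGT_iff_exists_Ioo_subset.1 hp₁
  obtain ⟨δ₂, hδ₂, h₂⟩ := Metric.eventually_nhds_iff.1 hp₂
  refine ⟨min δ₁ δ₂, lt_min hδ₁ hδ₂, fun t v ξ ht htδ hv hξ => ?_⟩
  have hz := hp (h₁ ⟨ht, htδ.trans_le (min_le_left _ _)⟩)
    (h₂ (by rw [dist_eq_norm]; exact hv.trans_le (min_le_right _ _)))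
  obtain ⟨i, hi⟩ := mem_polyhedralUnion.1 hξ.1
  have hev := eventually_all.2 fun j => hz i j (hi j)
  exact ⟨inner_eq_zero_of_mem_regularNormalCone hξ
      (hev.mono fun s h => mem_polyhedralUnion.2 ⟨i, fun j => (h j).1⟩),
    inner_eq_zero_of_mem_regularNormalCone hξ
      (hev.mono fun s h => mem_polyhedralUnion.2 ⟨i, fun j => (h j).2⟩)⟩

end Polyhedral

/-! ### Solvability of perturbed inclusions by penalization -/

section Penalization

variable {E F : Type*} [NormedAddCommGroup E] [InnerProductSpace ℝ E] [ProperSpace E]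
  [NormedAddCommGroup F] [InnerProductSpace ℝ F] [ProperSpace F]

/-- Optimality conditions for the penalized distance `‖g x - y‖ + σ * ‖x - x₁‖`: if
`g` misses `P` on a closed ball around `x₁` and `g x₁` is close enough to `P`, then a
minimizer `x` lies in the open ball, and a unit normal `ξ` to `P` at a nearest point `y` of
`g x` is almost annihilated by the adjoint derivative and does not increase towards `x - x₁`. -/
theorem exists_normal_of_forall_notMem {P : Set F} (hP : IsClosed P) {g : E → F} {x₁ : E}
    {R σ : ℝ} (hR : 0 < R) (hσ : 0 < σ) (hg : ContinuousOn g (Metric.closedBall x₁ R))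
    (hd : ∀ x ∈ Metric.ball x₁ R, DifferentiableAt ℝ g x)
    {y₁ : F} (hy₁ : y₁ ∈ P) (hlt : ‖g x₁ - y₁‖ < σ * R)
    (hno : ∀ x ∈ Metric.closedBall x₁ R, g x ∉ P) :
    ∃ x ∈ Metric.ball x₁ R, ∃ y ∈ P, ∃ ξ ∈ regularNormalCone P y, ‖ξ‖ = 1 ∧
      0 < inner ℝ ξ (g x - y) ∧ ‖g x - y‖ ≤ ‖g x₁ - y₁‖ ∧
      ‖ContinuousLinearMap.adjoint (fderiv ℝ g x) ξ‖ ≤ σ ∧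
      inner ℝ ξ (fderiv ℝ g x (x - x₁)) ≤ 0 := by
  have hne : P.Nonempty := ⟨y₁, hy₁⟩
  have hcont : ContinuousOn (fun x => Metric.infDist (g x) P + σ * ‖x - x₁‖)
      (Metric.closedBall x₁ R) :=
    ((Metric.continuous_infDist_pt P).comp_continuousOn hg).add (by fun_prop)
  obtain ⟨x, hxR, hmin⟩ := (isCompact_closedBall x₁ R).exists_isMinOn
    ⟨x₁, Metric.mem_closedBall_self hR.le⟩ hcont
  obtain ⟨y, hyP, hy⟩ := hP.exists_infDist_eq_dist hne (g x)
  rw [dist_eq_norm] at hy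
  have hx₁ := isMinOn_iff.1 hmin x₁ (Metric.mem_closedBall_self hR.le)
  have hinf₁ : Metric.infDist (g x₁) P ≤ ‖g x₁ - y₁‖ := by
    rw [← dist_eq_norm]
    exact Metric.infDist_le_dist_of_mem hy₁
  simp only [sub_self, norm_zero, mul_zero, add_zero, hy] at hx₁
  have hdn : 0 ≤ σ * ‖x - x₁‖ := by positivity
  have hxb : x ∈ Metric.ball x₁ R := by
    rw [Metric.mem_ball, dist_eq_norm]
    have := norm_nonneg (g x - y)
    exact lt_of_mul_lt_mul_left (by linarith) hσ.le
  have hpos : 0 < ‖g x - y‖ :=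
    norm_pos_iff.2 (sub_ne_zero.2 fun h => hno x hxR (h ▸ hyP))
  set ξ : F := ‖g x - y‖⁻¹ • (g x - y) with hξdef
  have hξN : ξ ∈ regularNormalCone P y := by
    refine unit_sub_mem_regularNormalCone hyP fun y' hy' => ?_
    rw [← hy, ← dist_eq_norm]
    exact Metric.infDist_le_dist_of_mem hy'
  have hξ1 : ‖ξ‖ = 1 := by
    rw [hξdef, norm_smul, norm_inv, norm_norm, inv_mul_cancel₀ hpos.ne']
  have hxd := hd x hxb
  -- first-order condition in a direction along which the penalty grows at rate at most `β`
  have hfirst : ∀ (w : E) (β : ℝ), (∀ s ∈ Set.Icc (0 : ℝ) 1, ‖x - x₁ + s • w‖ ≤ ‖x - x₁‖ + s * β) →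
      0 ≤ inner ℝ ξ (fderiv ℝ g x w) + σ * β := by
    intro w β hw
    have hline : HasDerivAt (fun s : ℝ => x + s • w) w 0 := by
      simpa using ((hasDerivAt_id (0 : ℝ)).smul_const w).const_add x
    have hgl : HasDerivAt (fun s : ℝ => g (x + s • w) - y) (fderiv ℝ g x w) 0 := by
      have h0 : HasFDerivAt g (fderiv ℝ g x) (x + (0 : ℝ) • w) := by
        simpa using hxd.hasFDerivAt
      exact (h0.comp_hasDerivAt (0 : ℝ) hline).sub_const y
    have hnorm : HasDerivAt (fun s : ℝ => ‖g (x + s • w) - y‖)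
        (inner ℝ ξ (fderiv ℝ g x w)) 0 := by
      have h1 := (hgl.norm_sq).sqrt (by simpa using hpos.ne')
      simp only [Real.sqrt_sq (norm_nonneg _), zero_smul, add_zero] at h1
      convert h1 using 1
      rw [hξdef, real_inner_smul_left]
      field_simp
    have hψ : HasDerivAt (fun s : ℝ => ‖g (x + s • w) - y‖ + σ * (s * β))
        (inner ℝ ξ (fderiv ℝ g x w) + σ * β) 0 := by
      have h1 : HasDerivAt (fun s : ℝ => σ * (s * β)) (σ * β) 0 := by
        simpa using ((hasDerivAt_id (0 : ℝ)).mul_const β).const_mul σ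
      exact hnorm.add h1
    have hge : ∀ᶠ s : ℝ in 𝓝[>] 0, 0 ≤ slope
        (fun s : ℝ => ‖g (x + s • w) - y‖ + σ * (s * β)) 0 s := by
      have hin : ∀ᶠ s : ℝ in 𝓝[>] 0, x + s • w ∈ Metric.ball x₁ R := by
        refine (hline.continuousAt.eventually_mem ?_).filter_mono nhdsWithin_le_nhds
        simpa using Metric.isOpen_ball.mem_nhds hxb
      have h01 : ∀ᶠ s : ℝ in 𝓝[>] 0, s ∈ Set.Ioo (0 : ℝ) 1 := Ioo_mem_nhdsGT one_pos
      filter_upwards [hin, h01] with s hs hs1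
      have hm := isMinOn_iff.1 hmin (x + s • w) (Metric.ball_subset_closedBall hs)
      have hdist : Metric.infDist (g (x + s • w)) P ≤ ‖g (x + s • w) - y‖ := by
        rw [← dist_eq_norm]
        exact Metric.infDist_le_dist_of_mem hyP
      have hpen := hw s ⟨hs1.1.le, hs1.2.le⟩
      have hpen' : ‖x + s • w - x₁‖ ≤ ‖x - x₁‖ + s * β := by
        rwa [add_sub_right_comm]
      have := mul_le_mul_of_nonneg_left hpen' hσ.le
      rw [slope_def_field]
      refine div_nonneg ?_ (by linarith [hs1.1])
      simp only [zero_smul, add_zero, zero_mul, mul_zero]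
      rw [hy] at hm
      linarith
    exact ge_of_tendsto ((hasDerivAt_iff_tendsto_slope.1 hψ).mono_left (nhdsGT_le_nhdsNE 0)) hge
  refine ⟨x, hxb, y, hyP, ξ, hξN, hξ1, ?_, by linarith, ?_, ?_⟩
  · rw [hξdef, real_inner_smul_left, real_inner_self_eq_norm_sq]
    positivity
  · set ζ := ContinuousLinearMap.adjoint (fderiv ℝ g x) ξ with hζ
    have h := hfirst (-ζ) ‖ζ‖ fun s hs => (norm_add_le _ _).trans (by
      rw [norm_smul, norm_neg, Real.norm_of_nonneg hs.1])
    rw [map_neg, inner_neg_right, ← ContinuousLinearMap.adjoint_inner_left, ← hζ,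
      real_inner_self_eq_norm_sq] at h
    by_contra! hlt'
    nlinarith [norm_nonneg ζ]
  · have h := hfirst (-(x - x₁)) (-‖x - x₁‖) fun s hs => by
      have : x - x₁ + s • -(x - x₁) = (1 - s) • (x - x₁) := by module
      rw [this, norm_smul, Real.norm_of_nonneg (by linarith [hs.2])]
      linarith
    rw [map_neg, inner_neg_right] at h
    linarith


/-- The ball around `x₀ + t • u` in which solutions are sought lies in a ball around `x₀`. -/
theorem closedBall_add_smul_subset {E : Type*} [NormedAddCommGroup E] [NormedSpace ℝ E]
    {t ρ : ℝ} (ht : 0 < t) (hρ : ρ ≤ 1) (x₀ u : E) :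
    Metric.closedBall (x₀ + t • u) (ρ * t) ⊆ Metric.closedBall x₀ (t * (‖u‖ + 1)) := by
  refine Metric.closedBall_subset_closedBall' ?_
  rw [dist_eq_norm, add_sub_cancel_left, norm_smul, Real.norm_of_nonneg ht.le]
  nlinarith

theorem norm_inv_smul_sub_lt {F : Type*} [NormedAddCommGroup F] [NormedSpace ℝ F]
    {t c : ℝ} (ht : 0 < t) {y w : F} (h : ‖y - t • w‖ < t * c) : ‖t⁻¹ • y - w‖ < c := by
  have h1 : t⁻¹ • y - w = t⁻¹ • (y - t • w) := by
    rw [smul_sub, inv_smul_smul₀ ht.ne']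
  rw [h1, norm_smul, norm_inv, Real.norm_of_nonneg ht.le, inv_mul_lt_iff₀ ht]
  exact h

/-- First-order solvability: if unit normals near the direction `A u` are bounded away from
the kernel of the adjoint of `A`, then every map close to `x ↦ y₀ + A (x - x₀)`, with its
derivative, on the scale `t` takes a value in `P` at distance at most `t * (‖u‖ + 1)` from `x₀`. -/
theorem exists_mem_of_firstOrder {P : Set F} (hP : IsClosed P) (A : E →L[ℝ] F) (u : E) (y₀ : F)
    {c : ℝ} (hc : 0 < c)
    (hN : ∀ (t : ℝ) (v ξ : F), 0 < t → t < c → ‖v - A u‖ < c →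
      ξ ∈ regularNormalCone P (y₀ + t • v) → ‖ξ‖ = 1 →
      c ≤ ‖ContinuousLinearMap.adjoint A ξ‖) :
    ∃ η : ℝ, 0 < η ∧ ∀ t : ℝ, 0 < t → t < c → y₀ + t • A u ∈ P → ∀ (g : E → F) (x₀ : E),
      (∀ x ∈ Metric.closedBall x₀ (t * (‖u‖ + 1)), DifferentiableAt ℝ g x ∧
        ‖fderiv ℝ g x - A‖ ≤ η ∧ ‖g x - y₀ - A (x - x₀)‖ ≤ η * t) →
      ∃ x ∈ Metric.closedBall x₀ (t * (‖u‖ + 1)), g x ∈ P := by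
  obtain ⟨ρ, hρ0, hρ1, hρA⟩ : ∃ ρ : ℝ, 0 < ρ ∧ ρ ≤ 1 ∧ ‖A‖ * ρ ≤ c / 4 := by
    refine ⟨min 1 (c / (4 * (‖A‖ + 1))), by positivity, min_le_left _ _, ?_⟩
    calc ‖A‖ * min 1 (c / (4 * (‖A‖ + 1))) ≤ (‖A‖ + 1) * (c / (4 * (‖A‖ + 1))) := by
          gcongr
          · linarith
          · exact min_le_right _ _
      _ = c / 4 := by field_simp
  refine ⟨c * ρ / 8, by positivity, fun t ht htc hmem g x₀ hg => ?_⟩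
  by_contra! hno
  have hsub := closedBall_add_smul_subset ht hρ1 x₀ u
  have hg₁ := (hg _ (hsub (Metric.mem_closedBall_self (by positivity)))).2.2
  simp only [add_sub_cancel_left, map_smul] at hg₁
  obtain ⟨x, hx, y, hy, ξ, hξ, hξ1, -, hgx, hadj, -⟩ := exists_normal_of_forall_notMem hP
    (x₁ := x₀ + t • u) (R := ρ * t) (σ := c / 4) (by positivity) (by positivity)
    (fun x hx => (hg x (hsub hx)).1.continuousAt.continuousWithinAt)
    (fun x hx => (hg x (hsub (Metric.ball_subset_closedBall hx))).1) hmem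
    (by rw [← sub_sub]; nlinarith [mul_pos (mul_pos hc hρ0) ht])
    (fun x hx => hno x (hsub hx))
  obtain ⟨-, hDx, hTx⟩ := hg x (hsub (Metric.ball_subset_closedBall hx))
  rw [← sub_sub] at hgx
  have hdn : ‖x - (x₀ + t • u)‖ ≤ ρ * t := by
    rw [← dist_eq_norm]; exact (Metric.mem_ball.1 hx).le
  have hyn : ‖(y - y₀) - t • A u‖ < t * c := by
    have h1 : (y - y₀) - t • A u = -(g x - y) + (g x - y₀ - A (x - x₀))
        + A (x - (x₀ + t • u)) := by
      simp only [map_sub, map_add, map_smul]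
      abel
    have h2 : ‖A (x - (x₀ + t • u))‖ ≤ ‖A‖ * (ρ * t) := A.le_opNorm_of_le hdn
    have h3 : ‖(y - y₀) - t • A u‖ ≤ c * ρ / 8 * t + c * ρ / 8 * t + ‖A‖ * (ρ * t) := by
      rw [h1]
      refine (norm_add₃_le).trans ?_
      rw [norm_neg]
      linarith
    nlinarith [mul_pos hc ht, mul_le_mul_of_nonneg_right hρA ht.le,
      mul_le_mul_of_nonneg_right hρ1 (mul_pos hc ht).le]
  have hξ' : ξ ∈ regularNormalCone P (y₀ + t • t⁻¹ • (y - y₀)) := by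
    rwa [smul_inv_smul₀ ht.ne', add_sub_cancel]
  have hlow := hN t _ ξ ht htc (norm_inv_smul_sub_lt ht hyn) hξ' hξ1
  have hdiff : ‖ContinuousLinearMap.adjoint (fderiv ℝ g x - A) ξ‖ ≤ c * ρ / 8 := by
    refine (ContinuousLinearMap.le_opNorm _ _).trans ?_
    rw [hξ1, mul_one, LinearIsometryEquiv.norm_map]
    exact hDx
  rw [map_sub, sub_apply] at hdiff
  have := norm_sub_norm_le (ContinuousLinearMap.adjoint A ξ)
    (ContinuousLinearMap.adjoint (fderiv ℝ g x) ξ)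
  rw [norm_sub_rev] at this
  nlinarith

/-- The sign of the curvature term: if `ξ` is orthogonal to `A u`, has positive inner product
with `z`, which is `A h + H h h / 2` up to second order, and does not increase along `D d`, where
`D` is close to `A + H h`, then `inner ℝ ξ (H u u)` is almost nonnegative for `h` near `t • u`. -/
theorem lt_inner_bilin_of_normal {E F : Type*} [NormedAddCommGroup E] [NormedSpace ℝ E]
    [NormedAddCommGroup F] [InnerProductSpace ℝ F] {A D : E →L[ℝ] F} {H : E →L[ℝ] E →L[ℝ] F}
    {u d h : E} {ξ z : F} {t η ρ : ℝ} (ht : 0 < t) (hη : 0 ≤ η) (hρ1 : ρ ≤ 1) (hξ1 : ‖ξ‖ = 1)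
    (hdn : ‖d‖ ≤ ρ * t) (hhd : h = t • u + d) (hhn : ‖h‖ ≤ t * (‖u‖ + 1))
    (hTx : ‖z - A h - (1 / 2 : ℝ) • H h h‖ ≤ η * t ^ 2) (hDx : ‖D - A - H h‖ ≤ η * t)
    (hrad : inner ℝ ξ (D d) ≤ 0) (hAu : inner ℝ ξ (A u) = 0) (hz : 0 < inner ℝ ξ z) :
    -(4 * η + ‖H‖ * (4 * ‖u‖ + 3) * ρ) < inner ℝ ξ (H u u) := by
  have hin : ∀ z : F, inner ℝ ξ z ≤ ‖z‖ := fun z => by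
    simpa [hξ1] using real_inner_le_norm ξ z
  have hHh : ‖H h‖ ≤ ‖H‖ * (t * (‖u‖ + 1)) := H.le_opNorm_of_le hhn
  have e1 := (hin _).trans hTx
  have e3 : inner ℝ ξ (-((D - A - H h) d)) ≤ η * t * (ρ * t) := by
    refine (hin _).trans ?_
    rw [norm_neg]
    exact ContinuousLinearMap.le_of_opNorm_le_of_le _ hDx hdn
  have e4 : inner ℝ ξ (-(H h d)) ≤ ‖H‖ * (t * (‖u‖ + 1)) * (ρ * t) := by
    refine (hin _).trans ?_
    rw [norm_neg]
    exact (H h).le_of_opNorm_le_of_le hHh hdn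
  have e5 : inner ℝ ξ (H u d) ≤ ‖H‖ * ‖u‖ * (ρ * t) :=
    (hin _).trans ((H u).le_of_opNorm_le_of_le (H.le_opNorm u) hdn)
  have e6 : inner ℝ ξ (H d h) ≤ ‖H‖ * (ρ * t) * (t * (‖u‖ + 1)) :=
    (hin _).trans ((H d).le_of_opNorm_le_of_le (H.le_opNorm_of_le hdn) hhn)
  have hAh : inner ℝ ξ (A h) = inner ℝ ξ (A d) := by
    rw [hhd, map_add, map_smul, inner_add_right, real_inner_smul_right, hAu, mul_zero, zero_add]
  have hHhh : inner ℝ ξ (H h h) = t * (t * inner ℝ ξ (H u u)) + t * inner ℝ ξ (H u d)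
      + inner ℝ ξ (H d h) := by
    have hl : H h h = t • H u h + H d h := by
      rw [← smul_apply, ← map_smul, ← add_apply, ← map_add, ← hhd]
    have hr : H u h = t • H u u + H u d := by rw [← map_smul, ← map_add, ← hhd]
    rw [hl, hr]
    simp only [inner_add_right, real_inner_smul_right, mul_add]
  simp only [inner_sub_right, inner_neg_right, real_inner_smul_right, sub_apply] at e1 e3 e4
  have htu := mul_le_mul_of_nonneg_left e5 ht.le
  have hηρ : η * t * (ρ * t) ≤ η * t ^ 2 := by
    have := mul_le_of_le_one_left (by positivity : 0 ≤ η * t ^ 2) hρ1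
    linarith
  have ht2 := pow_pos ht 2
  have key : 0 < t ^ 2 * (inner ℝ ξ (H u u) + (4 * η + ‖H‖ * (4 * ‖u‖ + 3) * ρ)) := by
    linarith
  linarith [pos_of_mul_pos_right key ht2.le]

/-- Second-order solvability: it suffices that a unit normal `ξ` near the direction `A u` which is
almost annihilated by the adjoint of `A` makes the curvature term `inner ℝ ξ (H u u)` uniformly
negative, provided normals are orthogonal to the directions involved, as for polyhedral `P`. -/
theorem exists_mem_of_secondOrder {P : Set F} (hP : IsClosed P) (A : E →L[ℝ] F)
    (H : E →L[ℝ] E →L[ℝ] F) (u : E) (y₀ : F) {c : ℝ} (hc : 0 < c)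
    (hN : ∀ (t : ℝ) (v ξ : F), 0 < t → t < c → ‖v - A u‖ < c →
      ξ ∈ regularNormalCone P (y₀ + t • v) → ‖ξ‖ = 1 → inner ℝ ξ v = 0 ∧ inner ℝ ξ (A u) = 0 ∧
      (‖ContinuousLinearMap.adjoint A ξ‖ < c → inner ℝ ξ (H u u) ≤ -c)) :
    ∃ η : ℝ, 0 < η ∧ ∃ t₀ : ℝ, 0 < t₀ ∧ ∀ t : ℝ, 0 < t → t < t₀ → y₀ + t • A u ∈ P →
      ∀ (g : E → F) (x₀ : E),
      (∀ x ∈ Metric.closedBall x₀ (t * (‖u‖ + 1)), DifferentiableAt ℝ g x ∧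
        ‖fderiv ℝ g x - A - H (x - x₀)‖ ≤ η * t ∧
        ‖g x - y₀ - A (x - x₀) - (1 / 2 : ℝ) • H (x - x₀) (x - x₀)‖ ≤ η * t ^ 2) →
      ∃ x ∈ Metric.closedBall x₀ (t * (‖u‖ + 1)), g x ∈ P := by
  obtain ⟨ρ, hρ0, hρ1, hρA⟩ : ∃ ρ : ℝ, 0 < ρ ∧ ρ ≤ 1 ∧
      (‖A‖ + ‖H‖ * (4 * ‖u‖ + 3)) * ρ ≤ c / 4 := by
    set D := ‖A‖ + ‖H‖ * (4 * ‖u‖ + 3) with hD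
    have hD0 : 0 ≤ D := by positivity
    refine ⟨min 1 (c / (4 * (D + 1))), by positivity, min_le_left _ _, ?_⟩
    calc D * min 1 (c / (4 * (D + 1))) ≤ (D + 1) * (c / (4 * (D + 1))) := by
          gcongr
          · linarith
          · exact min_le_right _ _
      _ = c / 4 := by field_simp
  set K := ‖H‖ * ‖u‖ ^ 2 + 2 with hK
  have hK0 : 0 < K := by positivity
  clear_value K
  set B := K / ρ + K + 1 + ‖H‖ * (‖u‖ + 1) + ‖H‖ * (‖u‖ + 1) ^ 2 with hB
  have hB0 : 0 < B := by positivity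
  clear_value B
  refine ⟨min 1 (c / 16), by positivity, min c (c / (2 * B)), by positivity,
    fun t ht htt hmem g x₀ => ?_⟩
  have hη1 : min 1 (c / 16) ≤ 1 := min_le_left _ _
  have hη2 : min 1 (c / 16) ≤ c / 16 := min_le_right _ _
  have hη0 : 0 < min 1 (c / 16) := by positivity
  generalize min 1 (c / 16) = η at hη0 hη1 hη2
  intro hg
  have htc : t < c := htt.trans_le (min_le_left _ _)
  have htB : t * B < c / 2 := by
    have := htt.trans_le (min_le_right _ _)
    rw [lt_div_iff₀ (by positivity)] at this
    linarith
  by_contra! hno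
  have hsub := closedBall_add_smul_subset ht hρ1 x₀ u
  have hg₁ := (hg _ (hsub (Metric.mem_closedBall_self (by positivity)))).2.2
  simp only [add_sub_cancel_left, map_smul, smul_apply] at hg₁
  have hHuu : ‖H u u‖ ≤ ‖H‖ * ‖u‖ ^ 2 := by
    have := H.le_opNorm₂ u u
    rwa [mul_assoc, ← sq] at this
  have hstart : ‖g (x₀ + t • u) - (y₀ + t • A u)‖ < K * t / ρ * (ρ * t) := by
    have h1 : g (x₀ + t • u) - (y₀ + t • A u)
        = (g (x₀ + t • u) - y₀ - t • A u - (1 / 2 : ℝ) • t • t • H u u)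
          + (1 / 2 : ℝ) • t • t • H u u := by abel
    have h2 : ‖(1 / 2 : ℝ) • t • t • H u u‖ ≤ 1 / 2 * (t * (t * (‖H‖ * ‖u‖ ^ 2))) := by
      rw [norm_smul, norm_smul, norm_smul, Real.norm_of_nonneg ht.le,
        Real.norm_of_nonneg (by norm_num : (0 : ℝ) ≤ 1 / 2)]
      gcongr
    have h3 : K * t / ρ * (ρ * t) = K * t ^ 2 := by field_simp
    have h4 : 0 ≤ ‖H‖ * ‖u‖ ^ 2 * t ^ 2 := by positivity
    rw [h3, h1]
    refine (norm_add_le _ _).trans_lt ?_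
    rw [hK]
    nlinarith [pow_pos ht 2]
  obtain ⟨x, hx, y, hy, ξ, hξ, hξ1, hsign, hgx, hadj, hrad⟩ := exists_normal_of_forall_notMem hP
    (x₁ := x₀ + t • u) (R := ρ * t) (σ := K * t / ρ) (by positivity) (by positivity)
    (fun x hx => (hg x (hsub hx)).1.continuousAt.continuousWithinAt)
    (fun x hx => (hg x (hsub (Metric.ball_subset_closedBall hx))).1) hmem hstart
    (fun x hx => hno x (hsub hx))
  have hxb := hsub (Metric.ball_subset_closedBall hx)
  obtain ⟨-, hDx, hTx⟩ := hg x hxb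
  rw [mem_closedBall_iff_norm] at hxb
  have hdn : ‖x - (x₀ + t • u)‖ ≤ ρ * t := by
    rw [← dist_eq_norm]; exact (Metric.mem_ball.1 hx).le
  have hgx' : ‖g x - y‖ ≤ K * t ^ 2 := by
    have h3 : K * t / ρ * (ρ * t) = K * t ^ 2 := by field_simp
    linarith
  set d := x - (x₀ + t • u) with hd
  set h := x - x₀ with hh
  have hhd : h = t • u + d := by rw [hh, hd]; abel
  clear_value d h
  have hHh : ‖H h‖ ≤ ‖H‖ * (t * (‖u‖ + 1)) := H.le_opNorm_of_le hxb
  have hyn : ‖(y - y₀) - t • A u‖ < t * c := by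
    have h1 : (y - y₀) - t • A u = -(g x - y) + (g x - y₀ - A h - (1 / 2 : ℝ) • H h h)
        + (A d + (1 / 2 : ℝ) • H h h) := by
      have : A h = t • A u + A d := by rw [hhd, map_add, map_smul]
      rw [this]
      abel
    have h2 : ‖A d‖ ≤ ‖A‖ * (ρ * t) := A.le_opNorm_of_le hdn
    have h4 : ‖(1 / 2 : ℝ) • H h h‖ ≤ 1 / 2 * (‖H‖ * (t * (‖u‖ + 1)) * (t * (‖u‖ + 1))) := by
      rw [norm_smul, Real.norm_of_nonneg (by norm_num : (0 : ℝ) ≤ 1 / 2)]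
      gcongr
      exact (H h).le_of_opNorm_le_of_le hHh hxb
    have h3 : ‖(y - y₀) - t • A u‖ ≤ K * t ^ 2 + η * t ^ 2 + (‖A‖ * (ρ * t) +
        1 / 2 * (‖H‖ * (t * (‖u‖ + 1)) * (t * (‖u‖ + 1)))) := by
      rw [h1]
      refine (norm_add₃_le).trans ?_
      rw [norm_neg]
      linarith [norm_add_le (A d) ((1 / 2 : ℝ) • H h h)]
    have h5 : K + 1 + ‖H‖ * (‖u‖ + 1) ^ 2 ≤ B := by
      have : 0 ≤ K / ρ + ‖H‖ * (‖u‖ + 1) := by positivity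
      linarith
    have h6 : ‖A‖ * ρ ≤ c / 4 := by
      have : 0 ≤ ‖H‖ * (4 * ‖u‖ + 3) * ρ := by positivity
      nlinarith
    have h7 : 0 ≤ ‖H‖ * (‖u‖ + 1) ^ 2 * t ^ 2 := by positivity
    have h8 : η * t ^ 2 ≤ t ^ 2 := mul_le_of_le_one_left (pow_pos ht 2).le hη1
    calc ‖(y - y₀) - t • A u‖
        ≤ t * (‖A‖ * ρ + t * (K + 1 + ‖H‖ * (‖u‖ + 1) ^ 2)) := by
          rw [show t * (‖A‖ * ρ + t * (K + 1 + ‖H‖ * (‖u‖ + 1) ^ 2)) = K * t ^ 2 + t ^ 2 +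
            (‖A‖ * (ρ * t) + ‖H‖ * (‖u‖ + 1) ^ 2 * t ^ 2) by ring]
          rw [show ‖H‖ * (t * (‖u‖ + 1)) * (t * (‖u‖ + 1)) = ‖H‖ * (‖u‖ + 1) ^ 2 * t ^ 2
            by ring] at h3
          linarith
      _ ≤ t * (c / 4 + t * B) := by gcongr
      _ < t * c := by gcongr; linarith
  have hξ' : ξ ∈ regularNormalCone P (y₀ + t • t⁻¹ • (y - y₀)) := by
    rwa [smul_inv_smul₀ ht.ne', add_sub_cancel]
  obtain ⟨hv0, hAu, hlow⟩ := hN t _ ξ ht htc (norm_inv_smul_sub_lt ht hyn) hξ' hξ1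
  have hin : ∀ z : F, inner ℝ ξ z ≤ ‖z‖ := fun z => by
    simpa [hξ1] using real_inner_le_norm ξ z
  have hadjA : ‖ContinuousLinearMap.adjoint A ξ‖ < c := by
    have h1 : ‖fderiv ℝ g x - A‖ ≤ η * t + ‖H‖ * (t * (‖u‖ + 1)) := by
      have := norm_add_le (fderiv ℝ g x - A - H h) (H h)
      rw [sub_add_cancel] at this
      linarith
    have hdiff : ‖ContinuousLinearMap.adjoint (fderiv ℝ g x - A) ξ‖
        ≤ η * t + ‖H‖ * (t * (‖u‖ + 1)) := by
      refine (ContinuousLinearMap.le_opNorm _ _).trans ?_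
      rw [hξ1, mul_one, LinearIsometryEquiv.norm_map]
      exact h1
    rw [map_sub, sub_apply] at hdiff
    have h2 := norm_sub_norm_le (ContinuousLinearMap.adjoint A ξ)
      (ContinuousLinearMap.adjoint (fderiv ℝ g x) ξ)
    rw [norm_sub_rev] at h2
    have h3 : K / ρ + 1 + ‖H‖ * (‖u‖ + 1) ≤ B := by
      have : 0 ≤ K + ‖H‖ * (‖u‖ + 1) ^ 2 := by positivity
      linarith
    have h4 : K * t / ρ + (η * t + ‖H‖ * (t * (‖u‖ + 1))) ≤ t * B := by
      rw [show K * t / ρ + (η * t + ‖H‖ * (t * (‖u‖ + 1))) = t * (K / ρ + η + ‖H‖ * (‖u‖ + 1))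
        by ring]
      exact mul_le_mul_of_nonneg_left (by linarith) ht.le
    linarith
  have hneg := hlow hadjA
  -- the normal is orthogonal to `y - y₀`, so it separates `g x` from `y₀` as well
  have hz : 0 < inner ℝ ξ (g x - y₀) := by
    rw [real_inner_smul_right] at hv0
    have hy0 := (mul_eq_zero.1 hv0).resolve_left (inv_ne_zero ht.ne')
    rw [inner_sub_right] at hsign hy0 ⊢
    linarith
  have hρH : ‖H‖ * (4 * ‖u‖ + 3) * ρ ≤ c / 4 := by
    have : 0 ≤ ‖A‖ * ρ := by positivity
    linarith
  have hlow := lt_inner_bilin_of_normal ht hη0.le hρ1 hξ1 hdn hhd hxb hTx hDx hrad hAu hz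
  linarith

end Penalization

/-! ### Taylor estimates -/

section Taylor

variable {E F : Type*} [NormedAddCommGroup E] [NormedSpace ℝ E]
  [NormedAddCommGroup F] [NormedSpace ℝ F]

theorem norm_sub_sub_le_of_norm_fderiv_sub_le {g : E → F} {x₀ : E} {δ η : ℝ} {A : E →L[ℝ] F}
    (hd : ∀ x ∈ Metric.ball x₀ δ, DifferentiableAt ℝ g x)
    (hA : ∀ x ∈ Metric.ball x₀ δ, ‖fderiv ℝ g x - A‖ ≤ η) {x : E} (hx : x ∈ Metric.ball x₀ δ) :
    ‖g x - g x₀ - A (x - x₀)‖ ≤ η * ‖x - x₀‖ :=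
  (convex_ball x₀ δ).norm_image_sub_le_of_norm_hasFDerivWithin_le'
    (fun y hy => (hd y hy).hasFDerivAt.hasFDerivWithinAt) hA
    (Metric.mem_ball_self (Metric.pos_of_mem_ball hx)) hx

/-- Second-order Taylor estimate, with remainder controlled by the oscillation of the second
derivative around a fixed bilinear map `H`, which need not be its value at `x₀`. -/
theorem norm_taylor_two_le {g : E → F} {x₀ : E} {δ η : ℝ} {H : E →L[ℝ] E →L[ℝ] F}
    (hd : ∀ x ∈ Metric.ball x₀ δ, DifferentiableAt ℝ g x)
    (hdd : ∀ x ∈ Metric.ball x₀ δ, DifferentiableAt ℝ (fderiv ℝ g) x)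
    (hH : ∀ x ∈ Metric.ball x₀ δ, ‖fderiv ℝ (fderiv ℝ g) x - H‖ ≤ η)
    {x : E} (hx : x ∈ Metric.ball x₀ δ) :
    ‖g x - g x₀ - fderiv ℝ g x₀ (x - x₀) - (1 / 2 : ℝ) • H (x - x₀) (x - x₀)‖
      ≤ η * ‖x - x₀‖ ^ 2 := by
  set h := x - x₀ with hh
  have hη : 0 ≤ η := le_trans (norm_nonneg (fderiv ℝ (fderiv ℝ g) x - H)) (hH x hx)
  have hseg : ∀ s ∈ Set.Icc (0 : ℝ) 1, x₀ + s • h ∈ Metric.ball x₀ δ := fun s hs => by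
    rw [mem_ball_iff_norm, add_sub_cancel_left, norm_smul, Real.norm_of_nonneg hs.1]
    exact (mul_le_of_le_one_left (norm_nonneg _) hs.2).trans_lt (mem_ball_iff_norm.1 hx)
  -- the estimate is the mean value inequality for the remainder along the segment
  have hderiv : ∀ s ∈ Set.Icc (0 : ℝ) 1, HasDerivWithinAt
      (fun s : ℝ => g (x₀ + s • h) - s • fderiv ℝ g x₀ h - ((1 / 2 : ℝ) * s ^ 2) • H h h)
      (fderiv ℝ g (x₀ + s • h) h - fderiv ℝ g x₀ h - s • H h h) (Set.Icc 0 1) s := by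
    intro s hs
    have hline : HasDerivAt (fun s : ℝ => x₀ + s • h) h s := by
      simpa using ((hasDerivAt_id s).smul_const h).const_add x₀
    have h1 := (hd _ (hseg s hs)).hasFDerivAt.comp_hasDerivAt s hline
    have h2 : HasDerivAt (fun s : ℝ => s • fderiv ℝ g x₀ h) (fderiv ℝ g x₀ h) s := by
      simpa using (hasDerivAt_id s).smul_const (fderiv ℝ g x₀ h)
    have h3 : HasDerivAt (fun s : ℝ => (1 / 2 : ℝ) * s ^ 2) s s := by
      refine ((hasDerivAt_pow 2 s).const_mul (1 / 2 : ℝ)).congr_deriv ?_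
      norm_num
      ring
    exact ((h1.sub h2).sub (h3.smul_const (H h h))).hasDerivWithinAt
  have hbound : ∀ s ∈ Set.Ico (0 : ℝ) 1,
      ‖fderiv ℝ g (x₀ + s • h) h - fderiv ℝ g x₀ h - s • H h h‖ ≤ η * ‖h‖ ^ 2 := by
    intro s hs
    have hs' : s ∈ Set.Icc (0 : ℝ) 1 := ⟨hs.1, hs.2.le⟩
    have h1 := norm_sub_sub_le_of_norm_fderiv_sub_le hdd hH (hseg s hs')
    rw [add_sub_cancel_left, map_smul] at h1
    have h2 : ‖s • h‖ ≤ ‖h‖ := by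
      rw [norm_smul, Real.norm_of_nonneg hs.1]
      exact mul_le_of_le_one_left (norm_nonneg _) hs.2.le
    have h3 := (fderiv ℝ g (x₀ + s • h) - fderiv ℝ g x₀ - s • H h).le_of_opNorm_le
      (h1.trans (mul_le_mul_of_nonneg_left h2 hη)) h
    simpa [sq, mul_assoc] using h3
  have := norm_image_sub_le_of_norm_deriv_le_segment_01' hderiv hbound
  have hx' : x₀ + h = x := by rw [hh]; abel
  simp only [one_smul, zero_smul, one_pow, mul_one, add_zero, hx'] at this
  convert this using 2
  simp
  abel

end Taylor
/-! ### Parametric constraint systems -/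

section Parametric

variable {n m : ℕ} {Ω : Type*} {q : EuclideanSpace ℝ (Fin n) → Ω → EuclideanSpace ℝ (Fin m)}
  {x₀ : EuclideanSpace ℝ (Fin n)} {ω₀ : Ω}

theorem gradX_eq_fderiv (x : EuclideanSpace ℝ (Fin n)) (ω : Ω) :
    gradX q x ω = fderiv ℝ (fun y => q y ω) x := rfl

theorem norm_sub_le_perturbation_one (ω : Ω) :
    ‖q x₀ ω - q x₀ ω₀‖ ≤ perturbation q x₀ ω₀ 1 ω := by
  simp [perturbation]

theorem norm_gradX_sub_le_perturbation (l : ℕ) (ω : Ω) :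
    ‖gradX q x₀ ω - gradX q x₀ ω₀‖ ≤ perturbation q x₀ ω₀ l ω :=
  le_add_of_nonneg_right (by positivity)

theorem norm_sub_le_perturbation_two_sq (ω : Ω) :
    ‖q x₀ ω - q x₀ ω₀‖ ≤ perturbation q x₀ ω₀ 2 ω ^ 2 := by
  have h : ‖q x₀ ω - q x₀ ω₀‖ = (‖q x₀ ω - q x₀ ω₀‖ ^ (1 / ((2 : ℕ) : ℝ))) ^ 2 := by
    rw [← Real.rpow_natCast, ← Real.rpow_mul (norm_nonneg _)]
    norm_num
  conv_lhs => rw [h]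
  exact pow_le_pow_left₀ (by positivity) (le_add_of_nonneg_left (norm_nonneg _)) 2

/-- A feasible point in a ball of radius `r` around `x₀` bounds the distance to the feasible set. -/
theorem nonempty_and_infDist_le {P : Set (EuclideanSpace ℝ (Fin m))} {ω : Ω} {r : ℝ}
    (h : ∃ x ∈ Metric.closedBall x₀ r, q x ω ∈ P) :
    (feasibleSet q P ω).Nonempty ∧ Metric.infDist x₀ (feasibleSet q P ω) ≤ r := by
  obtain ⟨x, hx, hxP⟩ := h
  refine ⟨⟨x, hxP⟩, (Metric.infDist_le_dist_of_mem (show x ∈ feasibleSet q P ω from hxP)).trans ?_⟩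
  rw [dist_comm]
  exact hx

variable [TopologicalSpace Ω]

/-- Near `(x₀, ω₀)`, uniformly in `ω`, the map `q` is twice differentiable in `x`, with first and
second derivatives close to those at `(x₀, ω₀)`. -/
theorem BasicAssumption.exists_ball (hq : BasicAssumption q x₀ ω₀) {ε : ℝ} (hε : 0 < ε) :
    ∃ δ : ℝ, 0 < δ ∧ ∃ W ∈ 𝓝 ω₀, ∀ ω ∈ W, ∀ x ∈ Metric.ball x₀ δ,
      DifferentiableAt ℝ (fun y => q y ω) x ∧
      DifferentiableAt ℝ (fderiv ℝ (fun y => q y ω)) x ∧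
      ‖fderiv ℝ (fun y => q y ω) x - gradX q x₀ ω₀‖ ≤ ε ∧
      ‖fderiv ℝ (fderiv ℝ (fun y => q y ω)) x - hessX q x₀ ω₀‖ ≤ ε := by
  obtain ⟨U, hU, W, hW, hd, -⟩ := hq.exists_nhds
  have h1 : ∀ᶠ z : EuclideanSpace ℝ (Fin n) × Ω in 𝓝 (x₀, ω₀),
      gradX q z.1 z.2 ∈ Metric.ball (gradX q x₀ ω₀) ε :=
    hq.continuousAt_grad (Metric.ball_mem_nhds _ hε)
  have h2 : ∀ᶠ z : EuclideanSpace ℝ (Fin n) × Ω in 𝓝 (x₀, ω₀),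
      hessX q z.1 z.2 ∈ Metric.ball (hessX q x₀ ω₀) ε :=
    hq.continuousAt_hess (Metric.ball_mem_nhds (hessX q x₀ ω₀) hε)
  have h3 : ∀ᶠ z : EuclideanSpace ℝ (Fin n) × Ω in 𝓝 (x₀, ω₀), z ∈ U ×ˢ W :=
    prod_mem_nhds hU hW
  rw [nhds_prod_eq] at h1 h2 h3
  obtain ⟨p₁, hp₁, p₂, hp₂, hp⟩ := eventually_prod_iff.1 ((h1.and h2).and h3)
  obtain ⟨δ, hδ, hball⟩ := Metric.eventually_nhds_iff_ball.1 hp₁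
  refine ⟨δ, hδ, {ω | p₂ ω}, hp₂, fun ω hω x hx => ?_⟩
  obtain ⟨⟨hg, hh⟩, hxU, hωW⟩ := hp (hball x hx) hω
  exact ⟨(hd x hxU ω hωW).1, (hd x hxU ω hωW).2, (mem_ball_iff_norm.1 hg).le,
    ((mem_ball_iff_norm (b := hessX q x ω) (a := hessX q x₀ ω₀)).1 hh).le⟩

theorem BasicAssumption.continuousAt_q (hq : BasicAssumption q x₀ ω₀) :
    ContinuousAt (fun ω => q x₀ ω) ω₀ :=
  (hq.continuous_q.comp (by fun_prop : Continuous fun ω : Ω => (x₀, ω))).continuousAt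

theorem BasicAssumption.tendsto_perturbation (hq : BasicAssumption q x₀ ω₀) :
    Tendsto (perturbation q x₀ ω₀ 2) (𝓝 ω₀) (𝓝 0) := by
  have hg : ContinuousAt (fun ω => gradX q x₀ ω) ω₀ :=
    ContinuousAt.comp (f := fun ω : Ω => (x₀, ω))
      (g := fun z : EuclideanSpace ℝ (Fin n) × Ω => gradX q z.1 z.2)
      hq.continuousAt_grad (by fun_prop)
  have h : ContinuousAt (perturbation q x₀ ω₀ 2) ω₀ := by
    unfold perturbation
    refine (hg.sub continuousAt_const).norm.add ?_
    exact (hq.continuousAt_q.sub continuousAt_const).norm.rpow_const (Or.inr (by norm_num))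
  simpa [ContinuousAt, perturbation] using h

theorem BasicAssumption.hessForm_eq (hq : BasicAssumption q x₀ ω₀)
    (lam : EuclideanSpace ℝ (Fin m)) (u : EuclideanSpace ℝ (Fin n)) :
    hessForm q lam x₀ ω₀ u = inner ℝ lam (hessX q x₀ ω₀ u u) := by
  obtain ⟨δ, hδ, W, hW, h⟩ := hq.exists_ball one_pos
  have h₀ := h ω₀ (mem_of_mem_nhds hW)
  have hev : (fun y => fderiv ℝ (fun z => inner ℝ lam (q z ω₀)) y) =ᶠ[𝓝 x₀]
      fun y => (innerSL ℝ lam).comp (fderiv ℝ (fun z => q z ω₀) y) := by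
    filter_upwards [Metric.ball_mem_nhds x₀ hδ] with y hy
    exact ((innerSL ℝ lam).hasFDerivAt.comp y (h₀ y hy).1.hasFDerivAt).fderiv
  have hdd := (h₀ x₀ (Metric.mem_ball_self hδ)).2.1.hasFDerivAt
  have hcomp := ((ContinuousLinearMap.compL ℝ (EuclideanSpace ℝ (Fin n))
    (EuclideanSpace ℝ (Fin m)) ℝ (innerSL ℝ lam)).hasFDerivAt.comp x₀ hdd).fderiv
  rw [hessForm, hev.fderiv_eq]
  exact congrArg (fun L => L u u) hcomp

variable {p : ℕ} {r : Fin p → ℕ} {a : (i : Fin p) → Fin (r i) → EuclideanSpace ℝ (Fin m)}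
  {b : (i : Fin p) → Fin (r i) → ℝ}

/-- Lipschitz estimate under the first-order directional condition. -/
theorem BasicAssumption.exists_lipschitz_bound (hq : BasicAssumption q x₀ ω₀)
    (hx₀ : q x₀ ω₀ ∈ polyhedralUnion a b) {u : EuclideanSpace ℝ (Fin n)}
    (hu : u ∈ linearizedCone q (polyhedralUnion a b) ω₀ x₀)
    (hN : ∀ lam ∈ directionalNormalCone (polyhedralUnion a b) (q x₀ ω₀) (gradX q x₀ ω₀ u),
      ContinuousLinearMap.adjoint (gradX q x₀ ω₀) lam = 0 → lam = 0) :
    ∃ κ : ℝ, 0 < κ ∧ ∀ᶠ ω in 𝓝 ω₀, (feasibleSet q (polyhedralUnion a b) ω).Nonempty ∧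
      Metric.infDist x₀ (feasibleSet q (polyhedralUnion a b) ω) ≤
        κ * ‖q x₀ ω - q x₀ ω₀‖ := by
  set A := gradX q x₀ ω₀ with hA
  obtain ⟨c, hc, hcN⟩ := exists_pos_forall_regularNormalCone_of_directionalNormalCone
    (z := 0) hx₀ A fun lam hlam h0 _ => hN lam hlam h0
  obtain ⟨η, hη, hsolve⟩ := exists_mem_of_firstOrder isClosed_polyhedralUnion A u (q x₀ ω₀) hc
    fun t v ξ ht htc hv hξ hξ1 => by
      by_contra! hlt
      have := hcN t v ξ ht htc hv hξ hξ1 hlt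
      rw [inner_zero_right] at this
      linarith
  obtain ⟨δ₁, hδ₁, hray⟩ := mem_nhdsGT_iff_exists_Ioo_subset.1
    (eventually_add_smul_mem_polyhedralUnion hu)
  obtain ⟨ε, hε, hεη, hεu⟩ : ∃ ε : ℝ, 0 < ε ∧ ε ≤ η ∧ ε * (‖u‖ + 1) ≤ η / 2 := by
    refine ⟨min η (η / 2 / (‖u‖ + 1)), by positivity, min_le_left _ _, ?_⟩
    rw [← le_div_iff₀ (by positivity)]
    exact min_le_right _ _
  obtain ⟨δ₂, hδ₂, W, hW, hball⟩ := hq.exists_ball hε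
  -- the scale `t` is chosen so that the residual equals `η / 2 * t`
  have hsmall : Tendsto (fun ω => 2 / η * ‖q x₀ ω - q x₀ ω₀‖) (𝓝 ω₀) (𝓝 0) := by
    have := ((hq.continuousAt_q.sub continuousAt_const).norm.const_mul (2 / η) :
      ContinuousAt (fun ω => 2 / η * ‖q x₀ ω - q x₀ ω₀‖) ω₀)
    simpa [ContinuousAt] using this
  have hτ : 0 < min (min c δ₁) (δ₂ / (‖u‖ + 1)) := by
    have : 0 < δ₁ := hδ₁
    positivity
  refine ⟨2 / η * (‖u‖ + 1), by positivity, ?_⟩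
  filter_upwards [hW, hsmall.eventually_lt_const hτ] with ω hωW hlt
  set t := 2 / η * ‖q x₀ ω - q x₀ ω₀‖ with ht
  rw [lt_min_iff, lt_min_iff, lt_div_iff₀ (by positivity)] at hlt
  have hres : ‖q x₀ ω - q x₀ ω₀‖ = η / 2 * t := by rw [ht]; field_simp
  rw [show 2 / η * (‖u‖ + 1) * ‖q x₀ ω - q x₀ ω₀‖ = t * (‖u‖ + 1) by rw [ht]; ring]
  apply nonempty_and_infDist_le
  rcases (by positivity : 0 ≤ t).eq_or_lt with h0 | hpos
  · refine ⟨x₀, by simp [← h0], ?_⟩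
    have : ‖q x₀ ω - q x₀ ω₀‖ = 0 := by rw [hres, ← h0, mul_zero]
    rwa [sub_eq_zero.1 (norm_eq_zero.1 this)]
  refine hsolve t hpos hlt.1.1 (hray ⟨hpos, hlt.1.2⟩) (fun x => q x ω) x₀ fun x hx => ?_
  have hxb : x ∈ Metric.ball x₀ δ₂ := Metric.closedBall_subset_ball hlt.2 hx
  rw [mem_closedBall_iff_norm] at hx
  refine ⟨(hball ω hωW x hxb).1, (hball ω hωW x hxb).2.2.1.trans hεη, ?_⟩
  have hT := norm_sub_sub_le_of_norm_fderiv_sub_le (fun x hx => (hball ω hωW x hx).1)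
    (fun x hx => (hball ω hωW x hx).2.2.1) hxb
  have hsum : q x ω - q x₀ ω₀ - A (x - x₀)
      = (q x ω - q x₀ ω - A (x - x₀)) + (q x₀ ω - q x₀ ω₀) := by abel
  calc ‖q x ω - q x₀ ω₀ - A (x - x₀)‖
      ≤ ε * ‖x - x₀‖ + η / 2 * t := by
        rw [hsum, ← hres]
        exact (norm_add_le _ _).trans (add_le_add_left hT _)
    _ ≤ ε * (t * (‖u‖ + 1)) + η / 2 * t := by gcongr
    _ = ε * (‖u‖ + 1) * t + η / 2 * t := by ring
    _ ≤ η / 2 * t + η / 2 * t := by gcongr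
    _ = η * t := by ring

/-- Hölder estimate under the second-order directional condition. -/
theorem BasicAssumption.exists_holder_bound (hq : BasicAssumption q x₀ ω₀)
    (hx₀ : q x₀ ω₀ ∈ polyhedralUnion a b) {u : EuclideanSpace ℝ (Fin n)}
    (hu : u ∈ linearizedCone q (polyhedralUnion a b) ω₀ x₀)
    (hN : ∀ lam ∈ directionalNormalCone (polyhedralUnion a b) (q x₀ ω₀) (gradX q x₀ ω₀ u),
      ContinuousLinearMap.adjoint (gradX q x₀ ω₀) lam = 0 →
      0 ≤ hessForm q lam x₀ ω₀ u → lam = 0) :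
    ∃ κ : ℝ, 0 < κ ∧ ∀ᶠ ω in 𝓝 ω₀, (feasibleSet q (polyhedralUnion a b) ω).Nonempty ∧
      Metric.infDist x₀ (feasibleSet q (polyhedralUnion a b) ω) ≤
        κ * perturbation q x₀ ω₀ 2 ω := by
  simp only [hq.hessForm_eq] at hN
  set A := gradX q x₀ ω₀ with hA
  set H := hessX q x₀ ω₀ with hH
  obtain ⟨c₁, hc₁, hcN⟩ :=
    exists_pos_forall_regularNormalCone_of_directionalNormalCone hx₀ A hN
  obtain ⟨c₂, hc₂, horth⟩ := exists_pos_forall_inner_eq_zero (a := a) (b := b) (q x₀ ω₀) (A u)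
  obtain ⟨η₀, hη₀, t₀, ht₀, hsolve⟩ := exists_mem_of_secondOrder isClosed_polyhedralUnion A H u
    (q x₀ ω₀) (lt_min hc₁ hc₂) fun t v ξ ht htc hv hξ hξ1 => by
      rw [lt_min_iff] at htc hv
      obtain ⟨h1, h2⟩ := horth t v ξ ht htc.2 hv.2 hξ
      refine ⟨h1, h2, fun hlt => ?_⟩
      have := hcN t v ξ ht htc.1 hv.1 hξ hξ1 (hlt.trans_le (min_le_left _ _))
      linarith [min_le_left c₁ c₂]
  obtain ⟨δ₁, hδ₁, hray⟩ := mem_nhdsGT_iff_exists_Ioo_subset.1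
    (eventually_add_smul_mem_polyhedralUnion hu)
  obtain ⟨η, hη, hηη, hη1⟩ : ∃ η : ℝ, 0 < η ∧ η ≤ η₀ ∧ η ≤ 1 :=
    ⟨min η₀ 1, by positivity, min_le_left _ _, min_le_right _ _⟩
  obtain ⟨M, hM, hMu⟩ : ∃ M : ℝ, 1 ≤ M ∧ M = ‖u‖ + 1 := ⟨_, by simp, rfl⟩
  rw [← hMu] at hsolve
  have hM0 : 0 < M := by linarith
  obtain ⟨δ₂, hδ₂, W, hW, hball⟩ := hq.exists_ball (ε := η / (4 * M ^ 2)) (by positivity)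
  -- the scale `t` is chosen so that the perturbation measure equals `η / (4 * M) * t`
  have hsmall : Tendsto (fun ω => 4 * M / η * perturbation q x₀ ω₀ 2 ω) (𝓝 ω₀) (𝓝 0) := by
    simpa using hq.tendsto_perturbation.const_mul (4 * M / η)
  have hτ : 0 < min (min t₀ δ₁) (δ₂ / M) := by
    have : 0 < δ₁ := hδ₁
    positivity
  refine ⟨4 * M / η * M, by positivity, ?_⟩
  filter_upwards [hW, hsmall.eventually_lt_const hτ] with ω hωW hlt
  have hgrad := norm_gradX_sub_le_perturbation (q := q) (x₀ := x₀) (ω₀ := ω₀) 2 ω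
  have hval := norm_sub_le_perturbation_two_sq (q := q) (x₀ := x₀) (ω₀ := ω₀) ω
  have he : 0 ≤ perturbation q x₀ ω₀ 2 ω := (norm_nonneg _).trans hgrad
  generalize perturbation q x₀ ω₀ 2 ω = e at hgrad hval he hlt
  obtain ⟨t, ht⟩ : ∃ t, t = 4 * M / η * e := ⟨_, rfl⟩
  rw [← ht, lt_min_iff, lt_min_iff, lt_div_iff₀ hM0] at hlt
  have het : e = η / (4 * M) * t := by rw [ht]; field_simp
  rw [show 4 * M / η * M * e = t * M by rw [ht]; ring]
  apply nonempty_and_infDist_le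
  rcases (by rw [ht]; positivity : 0 ≤ t).eq_or_lt with h0 | hpos
  · refine ⟨x₀, by simp [← h0], ?_⟩
    rw [het, ← h0, mul_zero, zero_pow two_ne_zero] at hval
    rwa [sub_eq_zero.1 (norm_le_zero_iff.1 hval)]
  refine hsolve t hpos hlt.1.1 (hray ⟨hpos, hlt.1.2⟩) (fun x => q x ω) x₀ fun x hx => ?_
  have hxb : x ∈ Metric.ball x₀ δ₂ := Metric.closedBall_subset_ball hlt.2 hx
  rw [mem_closedBall_iff_norm] at hx
  have hT₁ := norm_sub_sub_le_of_norm_fderiv_sub_le (fun x hx => (hball ω hωW x hx).2.1)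
    (fun x hx => (hball ω hωW x hx).2.2.2) hxb
  have hT₂ := norm_taylor_two_le (fun x hx => (hball ω hωW x hx).1)
    (fun x hx => (hball ω hωW x hx).2.1) (fun x hx => (hball ω hωW x hx).2.2.2) hxb
  rw [← gradX_eq_fderiv] at hT₁ hT₂
  rw [← hA] at hgrad
  rw [← hH] at hT₁ hT₂
  have hθ : η / (4 * M) ≤ η / 4 := by
    gcongr
    linarith
  refine ⟨(hball ω hωW x hxb).1, ?_, ?_⟩
  · have hsum : fderiv ℝ (fun y => q y ω) x - A - H (x - x₀)
        = (fderiv ℝ (fun y => q y ω) x - gradX q x₀ ω - H (x - x₀))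
          + (gradX q x₀ ω - A) := by abel
    calc ‖fderiv ℝ (fun y => q y ω) x - A - H (x - x₀)‖
        ≤ η / (4 * M ^ 2) * ‖x - x₀‖ + e := by
          rw [hsum]
          exact (norm_add_le _ _).trans (add_le_add hT₁ hgrad)
      _ ≤ η / (4 * M ^ 2) * (t * M) + e := by gcongr
      _ = η / (4 * M) * t + η / (4 * M) * t := by rw [het]; field_simp
      _ ≤ η / 4 * t + η / 4 * t := by gcongr
      _ ≤ η₀ * t := by nlinarith
  · have hsum : q x ω - q x₀ ω₀ - A (x - x₀) - (1 / 2 : ℝ) • H (x - x₀) (x - x₀)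
        = (q x ω - q x₀ ω - gradX q x₀ ω (x - x₀) - (1 / 2 : ℝ) • H (x - x₀) (x - x₀))
          + (q x₀ ω - q x₀ ω₀) + (gradX q x₀ ω - A) (x - x₀) := by
      rw [sub_apply]
      abel
    calc ‖q x ω - q x₀ ω₀ - A (x - x₀) - (1 / 2 : ℝ) • H (x - x₀) (x - x₀)‖
        ≤ η / (4 * M ^ 2) * ‖x - x₀‖ ^ 2 + e ^ 2 + e * ‖x - x₀‖ := by
          rw [hsum]
          exact norm_add₃_le.trans (add_le_add (add_le_add hT₂ hval)
            (ContinuousLinearMap.le_of_opNorm_le _ hgrad _))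
      _ ≤ η / (4 * M ^ 2) * (t * M) ^ 2 + e ^ 2 + e * (t * M) := by gcongr
      _ = η / 4 * t ^ 2 + η / (4 * M) * (η / (4 * M)) * t ^ 2 + η / 4 * t ^ 2 := by
          rw [het]; field_simp
      _ ≤ η / 4 * t ^ 2 + 1 * (η / 4) * t ^ 2 + η / 4 * t ^ 2 := by
          gcongr
          linarith
      _ ≤ η₀ * t ^ 2 := by nlinarith [pow_pos hpos 2]

end Parametric

theorem mainTheorem4 {n m p : ℕ} {Ω : Type*} [TopologicalSpace Ω] {r : Fin p → ℕ}
    (a : (i : Fin p) → Fin (r i) → EuclideanSpace ℝ (Fin m))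
    (b : (i : Fin p) → Fin (r i) → ℝ)
    (q : EuclideanSpace ℝ (Fin n) → Ω → EuclideanSpace ℝ (Fin m))
    (x₀ : EuclideanSpace ℝ (Fin n)) (ω₀ : Ω)
    (hq : BasicAssumption q x₀ ω₀)
    (hx₀ : x₀ ∈ feasibleSet q (polyhedralUnion a b) ω₀) :
    ((∃ u ∈ linearizedCone q (polyhedralUnion a b) ω₀ x₀, u ≠ 0 ∧
        ∀ lam ∈ directionalNormalCone (polyhedralUnion a b) (q x₀ ω₀) (gradX q x₀ ω₀ u),
          ContinuousLinearMap.adjoint (gradX q x₀ ω₀) lam = 0 → lam = 0) →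
      ∃ κ : ℝ, 0 < κ ∧ ∃ W ∈ 𝓝 ω₀, ∀ ω ∈ W,
        (feasibleSet q (polyhedralUnion a b) ω).Nonempty ∧
        Metric.infDist x₀ (feasibleSet q (polyhedralUnion a b) ω) ≤
          κ * ‖q x₀ ω - q x₀ ω₀‖ ∧
        κ * ‖q x₀ ω - q x₀ ω₀‖ ≤ κ * perturbation q x₀ ω₀ 1 ω) ∧
    ((∃ u ∈ linearizedCone q (polyhedralUnion a b) ω₀ x₀, u ≠ 0 ∧
        ∀ lam ∈ directionalNormalCone (polyhedralUnion a b) (q x₀ ω₀) (gradX q x₀ ω₀ u),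
          ContinuousLinearMap.adjoint (gradX q x₀ ω₀) lam = 0 →
          0 ≤ hessForm q lam x₀ ω₀ u → lam = 0) →
      ∃ κ : ℝ, 0 < κ ∧ ∃ W ∈ 𝓝 ω₀, ∀ ω ∈ W,
        (feasibleSet q (polyhedralUnion a b) ω).Nonempty ∧
        Metric.infDist x₀ (feasibleSet q (polyhedralUnion a b) ω) ≤
          κ * perturbation q x₀ ω₀ 2 ω) := by
  refine ⟨?_, ?_⟩
  · rintro ⟨u, hu, -, hN⟩
    obtain ⟨κ, hκ, hW⟩ := hq.exists_lipschitz_bound hx₀ hu hN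
    exact ⟨κ, hκ, _, hW, fun ω hω => ⟨hω.1, hω.2,
      mul_le_mul_of_nonneg_left (norm_sub_le_perturbation_one ω) hκ.le⟩⟩
  · rintro ⟨u, hu, -, hN⟩
    obtain ⟨κ, hκ, hW⟩ := hq.exists_holder_bound hx₀ hu hN
    exact ⟨κ, hκ, _, hW, fun ω hω => hω⟩
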